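/- Let $F$ be a non-archimedean local field whose residue field has odd cardinality $q$, let $n\ge 1$, and put $I=\{1,\dots,n\}$. Then $$\sum_{\substack{\sigma\in\mathfrak S_n\\ \sigma^2=1}}(1-q^{-1})^{n-c_2(\sigma)}q^{-c_2(\sigma)}\sum_{I=I_0\cup\cdots\cup I_r}q^{-\tau(\{I_i\})-t(\sigma,\{I_i\})}\,\frac{q^{n(n+1)/2}}{\prod_{l=0}^r\left(q^{n(l)}-1\right)}=1.$$ Here the inner sum runs over all $r\ge 0$ and all ordered partitions $(I_0,\dots,I_r)$ of $I$ into non-empty, pairwise disjoint, $\sigma$-stable subsets, and $$c_2(\sigma)=\tfrac12\#\{i\in I\mid\sigma(i)\ne i\},\qquad \tau(\{I_i\})=\sum_{l=1}^r\#\{(i,j)\in I_l\times(I_0\cup\cdots\cup I_{l-1})\mid j<i\},$$ $$t(\sigma,\{I_i\})=\sum_{l=0}^r\#\{(i,j)\in I_l\times I_l\mid i<j<\sigma(i),\ \sigma(j)<\sigma(i)\},$$ $$n^{(l)}=\#I_l+\#I_{l+1}+\cdots+\#I_r,\qquad n(l)=\frac{n^{(l)}(n^{(l)}+1)}{2}\qquad(0\le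 l\le r).$$ -/

import Mathlib

open scoped ValuativeRel

namespace SiegelIdentity

/-- `I 0, …, I r` is an ordered partition of `{1, …, n}` (modelled by `Fin n`) into non-empty,
pairwise disjoint, `σ`-stable subsets. -/
def IsStablePartition {n r : ℕ} (σ : Equiv.Perm (Fin n)) (I : Fin (r + 1) → Finset (Fin n)) :
    Prop :=
  (∀ l, (I l).Nonempty) ∧
  (∀ l m, l ≠ m → Disjoint (I l) (I m)) ∧
  (∀ i, ∃ l, i ∈ I l) ∧
  (∀ l, ∀ i ∈ I l, σ i ∈ I l)

instance {n r : ℕ} (σ : Equiv.Perm (Fin n)) (I : Fin (r + 1) → Finset (Fin n)) :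
    Decidable (IsStablePartition σ I) := by
  unfold IsStablePartition; infer_instance

/-- All ordered partitions of `Fin n` into `r + 1` non-empty `σ`-stable blocks. -/
def stablePartitions {n : ℕ} (σ : Equiv.Perm (Fin n)) (r : ℕ) :
    Finset (Fin (r + 1) → Finset (Fin n)) :=
  Finset.univ.filter (IsStablePartition σ)

/-- All `σ ∈ 𝔖_n` with `σ² = 1`. -/
def involutions (n : ℕ) : Finset (Equiv.Perm (Fin n)) :=
  Finset.univ.filter (fun σ => σ ^ 2 = 1)

/-- Half the number of points moved by `σ` (an even number when `σ² = 1`). -/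
def c₂ {n : ℕ} (σ : Equiv.Perm (Fin n)) : ℕ :=
  (Finset.univ.filter (fun i => σ i ≠ i)).card / 2

/-- `∑_l #{(i, j) ∈ I_l × (I_0 ∪ ⋯ ∪ I_{l-1}) | j < i}`; the term `l = 0` is zero. -/
def tau {n r : ℕ} (I : Fin (r + 1) → Finset (Fin n)) : ℕ :=
  ∑ l, ((I l ×ˢ (Finset.univ.filter (fun m => m < l)).biUnion I).filter
    (fun p => p.2 < p.1)).card

/-- `∑_l #{(i, j) ∈ I_l × I_l | i < j < σ(i), σ(j) < σ(i)}`. -/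
def tInv {n r : ℕ} (σ : Equiv.Perm (Fin n)) (I : Fin (r + 1) → Finset (Fin n)) : ℕ :=
  ∑ l, ((I l ×ˢ I l).filter
    (fun p => p.1 < p.2 ∧ p.2 < σ p.1 ∧ σ p.2 < σ p.1)).card

/-- `n^{(l)} = #(I_l ∪ ⋯ ∪ I_r) = n_l + ⋯ + n_r`. -/
def nUpper {n r : ℕ} (I : Fin (r + 1) → Finset (Fin n)) (l : Fin (r + 1)) : ℕ :=
  ∑ m ∈ Finset.univ.filter (fun m => l ≤ m), (I m).card

/-- `n(l) = n^{(l)} (n^{(l)} + 1) / 2`. -/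
def nTri {n r : ℕ} (I : Fin (r + 1) → Finset (Fin n)) (l : Fin (r + 1)) : ℕ :=
  nUpper I l * (nUpper I l + 1) / 2

end SiegelIdentity

namespace SiegelIdentity

/-! Put `p = q⁻¹` and let `d k` be `symDensity p k`. The sums are exchanged, so that an ordered
partition is fixed first and the involutions stabilising its blocks are summed inside.

The inner sum equals `∏ d (#I_l)` (`sum_invWeight`). Colour points by their block and remove the
largest point `m`: it is either fixed or swapped with some `a` of its colour. Summing over `a` gives
a geometric series, and the result is the recursion defining `d`.

The sum over partitions is evaluated by removing the first block `A` from the underlying set `S`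
(`sum_partitionSum`): by induction it is `p ^ (#S (#S + 1) / 2)`, which cancels the prefactor `q ^
(n (n + 1) / 2)`. The induction step needs a sum over all subsets `A` of `S` to be 1. The q-binomial
theorem (`sum_powerset_crossCount`) turns that sum into `sum_antidiagonal_density`, which expresses
that every symmetric matrix has some rank; here it is proved with generating series. -/

/-! ### Symmetric densities and their generating series -/

/-- The proportion of invertible matrices among the symmetric `n × n` matrices over a field with
`p⁻¹` elements, through its two-term recursion. -/
noncomputable def symDensity (p : ℝ) : ℕ → ℝ
  | 0 => 1
  | 1 => 1 - p
  | n + 2 => (1 - p) * symDensity p (n + 1) + p * (1 - p ^ (n + 1)) * symDensity p n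

/-- The `q`-Pochhammer product `(1 - p) (1 - p²) ⋯ (1 - pⁿ)`. -/
noncomputable def pochhammer (p : ℝ) (n : ℕ) : ℝ := ∏ i ∈ Finset.range n, (1 - p ^ (i + 1))

theorem pochhammer_zero (p : ℝ) : pochhammer p 0 = 1 := by simp [pochhammer]

theorem pochhammer_succ (p : ℝ) (n : ℕ) :
    pochhammer p (n + 1) = pochhammer p n * (1 - p ^ (n + 1)) := by
  simp [pochhammer, Finset.prod_range_succ]

theorem one_sub_pow_succ_ne_zero {p : ℝ} (h0 : 0 < p) (h1 : p < 1) (n : ℕ) :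
    1 - p ^ (n + 1) ≠ 0 := by
  have := pow_lt_one₀ h0.le h1 (Nat.succ_ne_zero n)
  simp only [Nat.succ_eq_add_one] at this
  linarith

theorem pochhammer_ne_zero {p : ℝ} (h0 : 0 < p) (h1 : p < 1) (n : ℕ) : pochhammer p n ≠ 0 :=
  Finset.prod_ne_zero_iff.mpr fun i _ => one_sub_pow_succ_ne_zero h0 h1 i

theorem triangle_succ (m : ℕ) : (m + 1) * (m + 1 + 1) / 2 = m * (m + 1) / 2 + (m + 1) := by
  have : (m + 1) * (m + 1 + 1) = m * (m + 1) + (m + 1) * 2 := by ring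
  rw [this, Nat.add_mul_div_right _ _ (by norm_num)]

/-- The generating series `∑ symDensity p k xᵏ / (p; p)ₖ`. -/
noncomputable def densitySeries (p : ℝ) : PowerSeries ℝ :=
  PowerSeries.mk fun k => symDensity p k / pochhammer p k

/-- The generating series `∑ p ^ (k (k + 1) / 2) xᵏ / (p; p)ₖ`. -/
noncomputable def expSeries (p : ℝ) : PowerSeries ℝ :=
  PowerSeries.mk fun k => p ^ (k * (k + 1) / 2) / pochhammer p k

-- Comparing coefficients of `X ^ (n + 2)` gives exactly the recursion of `symDensity`, divided by
-- `pochhammer p (n + 1)`.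
open PowerSeries in
theorem rescale_densitySeries {p : ℝ} (h0 : 0 < p) (h1 : p < 1) :
    rescale p (densitySeries p) = (1 - X) * (1 + C p * X) * densitySeries p := by
  have e : (1 - X) * (1 + C p * X) * densitySeries p
      = densitySeries p - C (1 - p) * (X * densitySeries p)
        - C p * (X * (X * densitySeries p)) := by
    simp only [map_sub, map_one]; ring
  rw [e]
  ext n
  have hp := pochhammer_ne_zero h0 h1
  have h := one_sub_pow_succ_ne_zero h0 h1
  simp only [LinearMap.map_sub, coeff_rescale, coeff_C_mul]
  rcases n with _ | _ | n
  · simp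
  · have h' := h 0
    rw [coeff_succ_X_mul, coeff_succ_X_mul, coeff_zero_X_mul]
    simp [densitySeries, symDensity, pochhammer] at h' ⊢
    field_simp
    ring
  · simp only [coeff_succ_X_mul, densitySeries, coeff_mk, symDensity, pochhammer_succ]
    have := hp n; have := h n; have := h (n + 1)
    field_simp
    ring

-- This is the functional equation of Euler's product `∏_{i ≥ 1} (1 + pⁱ x)`.
open PowerSeries in
theorem expSeries_eq {p : ℝ} (h0 : 0 < p) (h1 : p < 1) :
    expSeries p = (1 + C p * X) * rescale p (expSeries p) := by
  have e : (1 + C p * X) * rescale p (expSeries p)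
      = rescale p (expSeries p) + C p * (X * rescale p (expSeries p)) := by ring
  rw [e]
  ext n
  have hp := pochhammer_ne_zero h0 h1
  have h := one_sub_pow_succ_ne_zero h0 h1
  simp only [map_add, coeff_rescale, coeff_C_mul]
  rcases n with _ | n
  · simp
  · simp only [coeff_succ_X_mul, expSeries, coeff_rescale, coeff_mk, pochhammer_succ,
      triangle_succ]
    have := hp n; have := h n
    field_simp
    ring

-- The factors `1 + p x` in the two functional equations cancel, so the product `G` satisfies `G(p
-- x) = (1 - x) G(x)`. This determines its coefficients recursively.
open PowerSeries in
theorem coeff_densitySeries_mul_expSeries {p : ℝ} (h0 : 0 < p) (h1 : p < 1) (n : ℕ) :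
    coeff n (densitySeries p * expSeries p) = (pochhammer p n)⁻¹ := by
  have key : rescale p (densitySeries p * expSeries p)
      = densitySeries p * expSeries p - X * (densitySeries p * expSeries p) := by
    rw [map_mul, rescale_densitySeries h0 h1]
    conv_rhs => rw [expSeries_eq h0 h1]
    ring
  induction n with
  | zero => simp [densitySeries, expSeries, symDensity, pochhammer]
  | succ n ih =>
    have := congrArg (coeff (n + 1)) key
    rw [coeff_rescale, map_sub, coeff_succ_X_mul, ih] at this
    have hp := pochhammer_ne_zero h0 h1 n
    have h := one_sub_pow_succ_ne_zero h0 h1 n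
    rw [pochhammer_succ, mul_inv, ← div_eq_mul_inv, eq_div_iff h]
    linarith

/-- The rank decomposition of symmetric matrices, normalised to total mass one. -/
theorem sum_antidiagonal_density {p : ℝ} (h0 : 0 < p) (h1 : p < 1) (n : ℕ) :
    ∑ kl ∈ Finset.HasAntidiagonal.antidiagonal n,
      pochhammer p n / (pochhammer p kl.1 * pochhammer p kl.2) *
        (symDensity p kl.1 * p ^ (kl.2 * (kl.2 + 1) / 2)) = 1 := by
  have h := coeff_densitySeries_mul_expSeries h0 h1 n
  rw [PowerSeries.coeff_mul] at h
  have hp := pochhammer_ne_zero h0 h1 n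
  rw [← mul_inv_cancel₀ hp, ← h, Finset.mul_sum]
  refine Finset.sum_congr rfl fun kl _ => ?_
  simp only [densitySeries, expSeries, PowerSeries.coeff_mk]
  ring

/-! ### Crossings and the q-binomial theorem -/

section Order

variable {α : Type*} [LinearOrder α]

/-- The number of pairs `(i, j) ∈ J × A` with `j < i`. -/
def crossCount (J A : Finset α) : ℕ := ((J ×ˢ A).filter fun x => x.2 < x.1).card

theorem crossCount_insert_right {J A : Finset α} {m : α} (hJ : ∀ x ∈ J, x < m) :
    crossCount J (insert m A) = crossCount J A := by
  unfold crossCount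
  congr 1
  ext ⟨i, j⟩
  simp only [Finset.mem_filter, Finset.mem_product, Finset.mem_insert]
  constructor
  · rintro ⟨⟨hi, rfl | hj⟩, hlt⟩
    · exact absurd (hJ i hi) hlt.asymm
    · exact ⟨⟨hi, hj⟩, hlt⟩
  · rintro ⟨⟨hi, hj⟩, hlt⟩
    exact ⟨⟨hi, Or.inr hj⟩, hlt⟩

theorem crossCount_insert_left {J A : Finset α} {m : α} (hm : m ∉ J) (hA : ∀ x ∈ A, x < m) :
    crossCount (insert m J) A = crossCount J A + A.card := by
  unfold crossCount
  have : ((insert m J ×ˢ A).filter fun x => x.2 < x.1)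
      = ((J ×ˢ A).filter fun x => x.2 < x.1) ∪ ({m} ×ˢ A) := by
    ext ⟨i, j⟩
    simp only [Finset.mem_filter, Finset.mem_product, Finset.mem_insert, Finset.mem_union,
      Finset.mem_singleton]
    constructor
    · rintro ⟨⟨rfl | hi, hj⟩, hlt⟩
      · exact Or.inr ⟨rfl, hj⟩
      · exact Or.inl ⟨⟨hi, hj⟩, hlt⟩
    · rintro (⟨⟨hi, hj⟩, hlt⟩ | ⟨rfl, hj⟩)
      · exact ⟨⟨Or.inr hi, hj⟩, hlt⟩
      · exact ⟨⟨Or.inl rfl, hj⟩, hA j hj⟩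
  rw [this, Finset.card_union_of_disjoint, Finset.card_product]
  · simp
  · rw [Finset.disjoint_left]
    rintro ⟨i, j⟩ h1 h2
    simp only [Finset.mem_filter, Finset.mem_product, Finset.mem_singleton] at h1 h2
    exact hm (h2.1 ▸ h1.1.1)

/-- The `q`-binomial theorem for subsets counted by crossings. -/
theorem sum_powerset_crossCount {p : ℝ} (h0 : 0 < p) (h1 : p < 1) (S : Finset α) :
    ∀ ψ : ℕ → ℕ → ℝ,
      ∑ A ∈ S.powerset, p ^ crossCount (S \ A) A * ψ A.card (S \ A).card
        = ∑ kl ∈ Finset.HasAntidiagonal.antidiagonal S.card,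
          pochhammer p S.card / (pochhammer p kl.1 * pochhammer p kl.2) * ψ kl.1 kl.2 := by
  have hp := pochhammer_ne_zero h0 h1
  have h := one_sub_pow_succ_ne_zero h0 h1
  induction S using Finset.induction_on_max with
  | empty => intro ψ; simp [crossCount, pochhammer]
  | insert m S hm ih =>
    -- The weight `ψ` stays arbitrary because the induction hypothesis is applied to two modified
    -- weights: one for `m` outside `A`, where `m` crosses all of `A`, and one for `m` in `A`, where
    -- it adds no crossing.
    intro ψ
    have hmS : m ∉ S := fun hh => lt_irrefl m (hm m hh)
    have e1 : ∀ A ∈ S.powerset, insert m S \ A = insert m (S \ A) := fun A hA => by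
      rw [Finset.insert_sdiff_of_notMem]
      exact fun hh => hmS (Finset.mem_powerset.mp hA hh)
    have e2 : ∀ A ∈ S.powerset, insert m S \ insert m A = S \ A := fun A hA => by
      rw [Finset.insert_sdiff_insert, Finset.sdiff_insert_of_notMem hmS]
    rw [Finset.sum_powerset_insert hmS]
    have f1 : ∑ A ∈ S.powerset, p ^ crossCount (insert m S \ A) A *
          ψ A.card (insert m S \ A).card
        = ∑ A ∈ S.powerset, p ^ crossCount (S \ A) A *
          (fun k l => p ^ k * ψ k (l + 1)) A.card (S \ A).card := by
      refine Finset.sum_congr rfl fun A hA => ?_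
      have hA' := Finset.mem_powerset.mp hA
      have : m ∉ S \ A := fun hh => hmS (Finset.mem_sdiff.mp hh).1
      rw [e1 A hA, crossCount_insert_left this fun x hx => hm x (hA' hx),
        Finset.card_insert_of_notMem this, pow_add]
      ring
    have f2 : ∑ A ∈ S.powerset, p ^ crossCount (insert m S \ insert m A) (insert m A) *
          ψ (insert m A).card (insert m S \ insert m A).card
        = ∑ A ∈ S.powerset, p ^ crossCount (S \ A) A *
          (fun k l => ψ (k + 1) l) A.card (S \ A).card := by
      refine Finset.sum_congr rfl fun A hA => ?_
      have hA' := Finset.mem_powerset.mp hA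
      rw [e2 A hA, crossCount_insert_right fun x hx => hm x (Finset.mem_sdiff.mp hx).1,
        Finset.card_insert_of_notMem fun hh => hmS (hA' hh)]
    rw [f1.trans (ih fun k l => p ^ k * ψ k (l + 1)), f2.trans (ih fun k l => ψ (k + 1) l),
      Finset.card_insert_of_notMem hmS]
    generalize S.card = n
    -- Pascal's rule for q-binomials, from `1 - p ^ (k + l) = p ^ k (1 - p ^ l) + (1 - p ^ k)`.
    have split : ∀ kl ∈ Finset.HasAntidiagonal.antidiagonal (n + 1),
        pochhammer p (n + 1) / (pochhammer p kl.1 * pochhammer p kl.2) * ψ kl.1 kl.2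
        = pochhammer p n * p ^ kl.1 * (1 - p ^ kl.2) /
            (pochhammer p kl.1 * pochhammer p kl.2) * ψ kl.1 kl.2
          + pochhammer p n * (1 - p ^ kl.1) /
            (pochhammer p kl.1 * pochhammer p kl.2) * ψ kl.1 kl.2 := by
      rintro ⟨k, l⟩ hkl
      have : n + 1 = k + l := (Finset.HasAntidiagonal.mem_antidiagonal.mp hkl).symm
      rw [pochhammer_succ, this, pow_add]
      ring
    rw [Finset.sum_congr rfl split, Finset.sum_add_distrib]
    congr 1
    · rw [Finset.Nat.sum_antidiagonal_succ']
      simp only [pow_zero, sub_self, mul_zero, zero_div, zero_mul, zero_add]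
      refine Finset.sum_congr rfl fun kl _ => ?_
      have := h kl.2; have := hp kl.1; have := hp kl.2
      rw [pochhammer_succ]
      field_simp
    · rw [Finset.Nat.sum_antidiagonal_succ]
      simp only [pow_zero, sub_self, mul_zero, zero_div, zero_mul, zero_add]
      refine Finset.sum_congr rfl fun kl _ => ?_
      have := h kl.1; have := hp kl.1; have := hp kl.2
      rw [pochhammer_succ]
      field_simp

/-! ### Ordered partitions, by removal of the first block -/

/-- Ordered partitions of `S` into `r` non-empty blocks. -/
def orderedPartitions [Fintype α] (r : ℕ) (S : Finset α) : Finset (Fin r → Finset α) :=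
  Finset.univ.filter fun I =>
    (∀ l, (I l).Nonempty) ∧ (∀ l m, l ≠ m → Disjoint (I l) (I m)) ∧ ∀ i, i ∈ S ↔ ∃ l, i ∈ I l

/-- The number of pairs `j < i` with `j` in an earlier block than `i`. -/
def crossings {r : ℕ} (I : Fin r → Finset α) : ℕ :=
  ∑ l, crossCount (I l) ((Finset.univ.filter fun m => m < l).biUnion I)

/-- The number of elements in block `l` and the later ones. -/
def upperCard {α : Type*} {r : ℕ} (I : Fin r → Finset α) (l : Fin r) : ℕ :=
  ∑ m ∈ Finset.univ.filter (fun m => l ≤ m), (I m).card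

theorem crossCount_union_right {J A B : Finset α} (h : Disjoint A B) :
    crossCount J (A ∪ B) = crossCount J A + crossCount J B := by
  unfold crossCount
  rw [Finset.product_union, Finset.filter_union, Finset.card_union_of_disjoint]
  refine Finset.disjoint_filter_filter ?_
  rw [Finset.disjoint_product]
  exact Or.inr h

theorem crossCount_biUnion_left {r : ℕ} {I : Fin r → Finset α} {A : Finset α}
    (h : ∀ l m, l ≠ m → Disjoint (I l) (I m)) :
    crossCount (Finset.univ.biUnion I) A = ∑ l, crossCount (I l) A := by
  unfold crossCount
  rw [← Finset.card_biUnion]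
  · congr 1
    ext ⟨i, j⟩
    simp only [Finset.mem_filter, Finset.mem_product, Finset.mem_biUnion, Finset.mem_univ,
      true_and]
    tauto
  · intro l _ m _ hlm
    refine Finset.disjoint_filter_filter ?_
    rw [Finset.disjoint_product]
    exact Or.inl (h l m hlm)

theorem mem_orderedPartitions [Fintype α] {r : ℕ} {S : Finset α} {I : Fin r → Finset α} :
    I ∈ orderedPartitions r S ↔ (∀ l, (I l).Nonempty) ∧
      (∀ l m, l ≠ m → Disjoint (I l) (I m)) ∧ ∀ i, i ∈ S ↔ ∃ l, i ∈ I l := by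
  simp [orderedPartitions]

theorem biUnion_eq_of_mem_orderedPartitions [Fintype α] {r : ℕ} {S : Finset α}
    {I : Fin r → Finset α} (h : I ∈ orderedPartitions r S) : Finset.univ.biUnion I = S := by
  ext i
  simp [(mem_orderedPartitions.mp h).2.2 i]

theorem cons_mem_orderedPartitions [Fintype α] {r : ℕ} {S A : Finset α} {I : Fin r → Finset α} :
    (Fin.cons A I : Fin (r + 1) → Finset α) ∈ orderedPartitions (r + 1) S ↔
      (A ⊆ S ∧ A.Nonempty) ∧ I ∈ orderedPartitions r (S \ A) := by
  simp only [mem_orderedPartitions, Fin.forall_fin_succ, Fin.exists_fin_succ, Fin.cons_zero,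
    Fin.cons_succ, Finset.mem_sdiff]
  constructor
  · rintro ⟨⟨hA, hI⟩, ⟨⟨-, hAI⟩, hd⟩, hS⟩
    refine ⟨⟨fun i hi => (hS i).mpr (Or.inl hi), hA⟩, hI,
      fun l m hlm => (hd l).2 m fun h => hlm (Fin.succ_injective _ h), fun i => ?_⟩
    rw [hS i]
    constructor
    · rintro ⟨h1 | h1, h2⟩
      · exact absurd h1 h2
      · exact h1
    · rintro ⟨l, hl⟩
      exact ⟨Or.inr ⟨l, hl⟩, fun hi =>
        Finset.disjoint_left.mp (hAI l (Fin.succ_ne_zero l).symm) hi hl⟩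
  · rintro ⟨⟨hAS, hA⟩, hI, hd, hS⟩
    have hAI : ∀ l, Disjoint A (I l) := fun l =>
      Finset.disjoint_left.mpr fun i hi hil => ((hS i).mpr ⟨l, hil⟩).2 hi
    refine ⟨⟨hA, hI⟩, ⟨⟨fun h => absurd rfl h, fun l _ => hAI l⟩, fun l =>
      ⟨fun _ => (hAI l).symm, fun m hlm => hd l m fun h => hlm (h ▸ rfl)⟩⟩, fun i => ?_⟩
    rw [← hS i]
    by_cases hi : i ∈ A
    · simp [hi, hAS hi]
    · simp [hi]

theorem sum_orderedPartitions_succ [Fintype α] {r : ℕ} (S : Finset α)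
    (f : (Fin (r + 1) → Finset α) → ℝ) :
    ∑ I ∈ orderedPartitions (r + 1) S, f I
      = ∑ A ∈ S.powerset.filter Finset.Nonempty, ∑ I ∈ orderedPartitions r (S \ A),
          f (Fin.cons A I) := by
  rw [Finset.sum_sigma']
  refine Finset.sum_nbij' (fun I => ⟨I 0, Fin.tail I⟩) (fun x => Fin.cons x.1 x.2) ?_ ?_ ?_ ?_ ?_
  · intro I hI
    rw [← Fin.cons_self_tail I, cons_mem_orderedPartitions] at hI
    simpa using hI
  · rintro ⟨A, I⟩ h
    rw [cons_mem_orderedPartitions]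
    simpa using h
  · intro I _
    exact Fin.cons_self_tail I
  · rintro ⟨A, I⟩ _
    simp
  · intro I _
    simp

/-- Crossings of the later blocks with the first block `A` depend only on their union `J`. -/
theorem crossings_cons [Fintype α] {r : ℕ} {J A : Finset α} {I : Fin r → Finset α}
    (h : I ∈ orderedPartitions r J) (hAJ : Disjoint A J) :
    crossings (Fin.cons A I : Fin (r + 1) → Finset α) = crossCount J A + crossings I := by
  have hI := mem_orderedPartitions.mp h
  have hAI : ∀ l, Disjoint A (I l) := fun l =>
    hAJ.mono_right fun i hi => (hI.2.2 i).mpr ⟨l, hi⟩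
  have hu : ∀ l : Fin r, (Finset.univ.filter fun m => m < l.succ).biUnion
      (Fin.cons A I : Fin (r + 1) → Finset α)
      = A ∪ (Finset.univ.filter fun m => m < l).biUnion I := fun l => by
    ext i
    simp [Fin.exists_fin_succ]
  unfold crossings
  rw [Fin.sum_univ_succ]
  simp only [Fin.cons_zero, Fin.cons_succ, hu]
  rw [← biUnion_eq_of_mem_orderedPartitions h, crossCount_biUnion_left hI.2.1,
    ← Finset.sum_add_distrib]
  have hz : crossCount A ((Finset.univ.filter fun m => m < (0 : Fin (r + 1))).biUnion
      (Fin.cons A I : Fin (r + 1) → Finset α)) = 0 := by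
    simp [crossCount]
  rw [hz, zero_add]
  refine Finset.sum_congr rfl fun l _ => crossCount_union_right ?_
  rw [Finset.disjoint_biUnion_right]
  exact fun m _ => hAI m

theorem upperCard_cons_succ {α : Type*} {r : ℕ} (A : Finset α) (I : Fin r → Finset α) (l : Fin r) :
    upperCard (Fin.cons A I : Fin (r + 1) → Finset α) l.succ = upperCard I l := by
  simp only [upperCard, Finset.sum_filter, Fin.sum_univ_succ, Fin.cons_succ,
    Fin.succ_le_succ_iff]
  simp

theorem upperCard_zero_of_mem [Fintype α] {r : ℕ} {S : Finset α} {I : Fin (r + 1) → Finset α}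
    (h : I ∈ orderedPartitions (r + 1) S) : upperCard I 0 = S.card := by
  rw [← biUnion_eq_of_mem_orderedPartitions h, Finset.card_biUnion]
  · simp [upperCard]
  · exact fun l _ m _ => (mem_orderedPartitions.mp h).2.1 l m

/-- The weighted number of ordered partitions of `S` into `r` blocks. -/
noncomputable def partitionSum [Fintype α] (p : ℝ) (r : ℕ) (S : Finset α) : ℝ :=
  ∑ I ∈ orderedPartitions r S, p ^ crossings I *
    ∏ l, (symDensity p (I l).card / (p⁻¹ ^ (upperCard I l * (upperCard I l + 1) / 2) - 1))

theorem partitionSum_zero [Fintype α] (p : ℝ) {S : Finset α} :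
    partitionSum p 0 S = if S = ∅ then 1 else 0 := by
  have : orderedPartitions 0 S = if S = ∅ then Finset.univ else ∅ := by
    ext I
    rw [mem_orderedPartitions]
    split_ifs with h
    · exact iff_of_true ⟨fun l => l.elim0, fun l => l.elim0, by simp [h]⟩ (Finset.mem_univ I)
    · simpa [Finset.eq_empty_iff_forall_notMem] using h
  rw [partitionSum, this]
  split_ifs with h
  · simp [crossings]
  · simp

theorem partitionSum_succ [Fintype α] (p : ℝ) (r : ℕ) (S : Finset α) :
    partitionSum p (r + 1) S = ∑ A ∈ S.powerset.filter Finset.Nonempty,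
      p ^ crossCount (S \ A) A *
        (symDensity p A.card / (p⁻¹ ^ (S.card * (S.card + 1) / 2) - 1)) *
        partitionSum p r (S \ A) := by
  rw [partitionSum, sum_orderedPartitions_succ]
  refine Finset.sum_congr rfl fun A hA => ?_
  rw [partitionSum, Finset.mul_sum]
  refine Finset.sum_congr rfl fun I hI => ?_
  have hm : (Fin.cons A I : Fin (r + 1) → Finset α) ∈ orderedPartitions (r + 1) S := by
    rw [cons_mem_orderedPartitions]
    simpa using ⟨by simpa using hA, hI⟩
  rw [crossings_cons hI Finset.disjoint_sdiff, Fin.prod_univ_succ, upperCard_zero_of_mem hm,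
    pow_add]
  simp only [Fin.cons_zero, Fin.cons_succ, upperCard_cons_succ]
  ring

/-- The bound `N` makes the sum over the number of blocks finite without losing terms: blocks are
non-empty, so there are at most `S.card` of them. The case of no blocks is included and accounts for
`S = ∅`. -/
theorem sum_partitionSum [Fintype α] {p : ℝ} (h0 : 0 < p) (h1 : p < 1) (N : ℕ) :
    ∀ S : Finset α, S.card < N →
      ∑ r ∈ Finset.range N, partitionSum p r S = p ^ (S.card * (S.card + 1) / 2) := by
  induction N with
  | zero => intro S hS; omega
  | succ N ih =>
    intro S hS
    rw [Finset.sum_range_succ', partitionSum_zero]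
    rcases S.eq_empty_or_nonempty with rfl | hne
    · rw [if_pos rfl, Finset.sum_eq_zero]
      · simp
      · intro r _
        rw [partitionSum_succ]
        refine Finset.sum_eq_zero fun A hA => ?_
        simp only [Finset.powerset_empty, Finset.mem_filter, Finset.mem_singleton] at hA
        exact absurd hA.1 hA.2.ne_empty
    rw [if_neg hne.ne_empty, add_zero]
    simp only [partitionSum_succ]
    rw [Finset.sum_comm]
    set T := S.card * (S.card + 1) / 2 with hT
    have hpos : 0 < S.card := hne.card_pos
    have hT0 : T ≠ 0 := by
      obtain ⟨k, hk⟩ : ∃ k, S.card = k + 1 := ⟨S.card - 1, by omega⟩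
      rw [hT, hk, triangle_succ]
      omega
    have hlt : p ^ T < 1 := pow_lt_one₀ h0.le h1 hT0
    have hpT : 0 < p ^ T := pow_pos h0 T
    have hd : p⁻¹ ^ T - 1 ≠ 0 := by
      have := (one_lt_inv₀ hpT).mpr hlt
      rw [← inv_pow] at this
      linarith
    have key := (sum_powerset_crossCount h0 h1 S
      fun k l => symDensity p k * p ^ (l * (l + 1) / 2)).trans
        (sum_antidiagonal_density h0 h1 S.card)
    have hsplit : (∅ : Finset α) ∈ S.powerset := by simp
    -- The term `A = ∅` is `p ^ T`, so the non-empty `A` contribute `1 - p ^ T`; division by `p⁻¹ ^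
    -- T - 1` gives `p ^ T` again.
    rw [← Finset.add_sum_erase _ _ hsplit] at key
    have he : S.powerset.erase ∅ = S.powerset.filter Finset.Nonempty := by
      ext A
      simp [Finset.nonempty_iff_ne_empty, and_comm]
    rw [he] at key
    have hA : ∀ A ∈ S.powerset.filter Finset.Nonempty,
        ∑ r ∈ Finset.range N, p ^ crossCount (S \ A) A *
          (symDensity p A.card / (p⁻¹ ^ T - 1)) * partitionSum p r (S \ A)
        = p ^ crossCount (S \ A) A * (symDensity p A.card *
          p ^ ((S \ A).card * ((S \ A).card + 1) / 2)) / (p⁻¹ ^ T - 1) := by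
      intro A hA
      simp only [Finset.mem_filter, Finset.mem_powerset] at hA
      have hc : (S \ A).card < N := by
        have := Finset.card_sdiff_add_card_eq_card hA.1
        have := hA.2.card_pos
        omega
      rw [← Finset.mul_sum, ih _ hc]
      ring
    rw [Finset.sum_congr rfl hA, ← Finset.sum_div, div_eq_iff hd]
    simp only [crossCount, Finset.product_empty, Finset.filter_empty, Finset.card_empty, pow_zero,
      Finset.sdiff_empty, symDensity, one_mul, ← hT] at key
    have : p ^ T * (p⁻¹ ^ T - 1) = 1 - p ^ T := by
      rw [mul_sub, ← mul_pow, mul_inv_cancel₀ h0.ne', one_pow, mul_one]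
    rw [this]
    simp only [crossCount]
    linarith

/-! ### Weighted involutions preserving a colouring -/

/-- The number of larger elements takes each value `0, …, #T - 1` exactly once. -/
theorem sum_pow_card_gt (p : ℝ) (T : Finset α) :
    ∑ a ∈ T, p ^ (T.filter fun j => a < j).card = ∑ k ∈ Finset.range T.card, p ^ k := by
  induction T using Finset.induction_on_max with
  | empty => simp
  | insert m T hm ih =>
    have hmT : m ∉ T := fun hh => lt_irrefl m (hm m hh)
    rw [Finset.sum_insert hmT, Finset.card_insert_of_notMem hmT, geom_sum_succ, ← ih,
      Finset.mul_sum, add_comm]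
    congr 1
    · refine Finset.sum_congr rfl fun a ha => ?_
      rw [Finset.filter_insert, if_pos (hm a ha), Finset.card_insert_of_notMem, pow_succ, mul_comm]
      exact fun hh => hmT (Finset.mem_filter.mp hh).1
    · have : (insert m T).filter (fun j => m < j) = ∅ := by
        ext j
        simp only [Finset.mem_filter, Finset.mem_insert, Finset.notMem_empty, iff_false, not_and,
          not_lt]
        rintro (rfl | hj)
        · exact le_rfl
        · exact (hm j hj).le
      rw [this]; simp

variable {ι : Type*} [DecidableEq ι] [Fintype α]

/-- The involutions supported on `S` that preserve the colouring `c`. -/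
def colorInvolutions (S : Finset α) (c : α → ι) : Finset (Equiv.Perm α) :=
  Finset.univ.filter fun σ => σ ^ 2 = 1 ∧ (∀ i, i ∉ S → σ i = i) ∧ ∀ i, c (σ i) = c i

/-- Half the number of points moved by `σ`. -/
def halfSupport (σ : Equiv.Perm α) : ℕ := (Finset.univ.filter fun i => σ i ≠ i).card / 2

/-- The monochromatic pairs `(i, j)` in `S` with `i < j < σ i` and `σ j < σ i`. -/
def colorPairs (S : Finset α) (c : α → ι) (σ : Equiv.Perm α) : Finset (α × α) :=
  (S ×ˢ S).filter fun x => c x.1 = c x.2 ∧ x.1 < x.2 ∧ x.2 < σ x.1 ∧ σ x.2 < σ x.1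

/-- The weight of a colour-preserving involution on `S`. -/
noncomputable def invWeight (p : ℝ) (S : Finset α) (c : α → ι) (σ : Equiv.Perm α) : ℝ :=
  (1 - p) ^ (S.card - halfSupport σ) * p ^ (halfSupport σ + (colorPairs S c σ).card)

theorem mem_colorInvolutions {S : Finset α} {c : α → ι} {σ : Equiv.Perm α} :
    σ ∈ colorInvolutions S c ↔
      (∀ i, σ (σ i) = i) ∧ (∀ i, i ∉ S → σ i = i) ∧ ∀ i, c (σ i) = c i := by
  simp [colorInvolutions, Equiv.ext_iff, sq]

theorem apply_mem_of_mem {S : Finset α} {c : α → ι} {σ : Equiv.Perm α}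
    (h : σ ∈ colorInvolutions S c) {i : α} (hi : i ∈ S) : σ i ∈ S := by
  obtain ⟨h1, h2, -⟩ := mem_colorInvolutions.mp h
  by_contra hc
  have := h2 _ hc
  rw [h1] at this
  exact hc (this ▸ hi)

theorem halfSupport_le {S : Finset α} {c : α → ι} {σ : Equiv.Perm α}
    (h : σ ∈ colorInvolutions S c) : halfSupport σ ≤ S.card := by
  refine (Nat.div_le_self _ _).trans (Finset.card_le_card fun i hi => ?_)
  by_contra hc
  exact (Finset.mem_filter.mp hi).2 ((mem_colorInvolutions.mp h).2.1 i hc)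

theorem colorInvolutions_filter_fixed {S : Finset α} (c : α → ι) (m : α) :
    (colorInvolutions S c).filter (fun σ => σ m = m) = colorInvolutions (S.erase m) c := by
  ext σ
  simp only [Finset.mem_filter, mem_colorInvolutions, Finset.mem_erase, not_and_or, not_not]
  constructor
  · rintro ⟨⟨h1, h2, h3⟩, h4⟩
    refine ⟨h1, ?_, h3⟩
    rintro i (rfl | hi)
    exacts [h4, h2 i hi]
  · rintro ⟨h1, h2, h3⟩
    exact ⟨⟨h1, fun i hi => h2 i (Or.inr hi), h3⟩, h2 m (Or.inl rfl)⟩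

/-- A fixed maximum lies in no counted pair: `i < j < σ i` excludes it as `i`, and `σ i ≤ m`
excludes it as `j`. -/
theorem invWeight_of_fixed (p : ℝ) {S : Finset α} {c : α → ι} {m : α} (hm : m ∈ S)
    (hmax : ∀ x ∈ S, x ≤ m) {σ : Equiv.Perm α} (hσ : σ ∈ colorInvolutions (S.erase m) c) :
    invWeight p S c σ = (1 - p) * invWeight p (S.erase m) c σ := by
  have hle := halfSupport_le hσ
  obtain ⟨h1, h2, -⟩ := mem_colorInvolutions.mp hσ
  have hσm : σ m = m := h2 m (by simp)
  have hpairs : colorPairs S c σ = colorPairs (S.erase m) c σ := by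
    ext ⟨i, j⟩
    simp only [colorPairs, Finset.mem_filter, Finset.mem_product, Finset.mem_erase]
    constructor
    · rintro ⟨⟨hi, hj⟩, hc, hij, hjs, hs⟩
      have him : i ≠ m := by
        rintro rfl
        exact absurd (hij.trans hjs) (by rw [hσm]; exact lt_irrefl _)
      have hsi : σ i ≤ m := hmax _ (Finset.mem_of_mem_erase
        (apply_mem_of_mem hσ (Finset.mem_erase.mpr ⟨him, hi⟩)))
      exact ⟨⟨⟨him, hi⟩, (hjs.trans_le hsi).ne, hj⟩, hc, hij, hjs, hs⟩
    · rintro ⟨⟨⟨_, hi⟩, _, hj⟩, h⟩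
      exact ⟨⟨hi, hj⟩, h⟩
  have hcard := Finset.card_erase_add_one hm
  rw [invWeight, invWeight, hpairs, ← hcard,
    show (S.erase m).card + 1 - halfSupport σ = (S.erase m).card - halfSupport σ + 1 by omega,
    pow_succ]
  ring

theorem swap_mul_mem {S : Finset α} {c : α → ι} {m a : α} (hm : m ∈ S) (ha : a ∈ S)
    (hc : c a = c m) {σ : Equiv.Perm α}
    (hσ : σ ∈ colorInvolutions ((S.erase m).erase a) c) :
    Equiv.swap a m * σ ∈ colorInvolutions S c ∧ (Equiv.swap a m * σ) m = a := by
  obtain ⟨h1, h2, h3⟩ := mem_colorInvolutions.mp hσ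
  have hσm : σ m = m := h2 m (by simp)
  have hσa : σ a = a := h2 a (by simp)
  refine ⟨mem_colorInvolutions.mpr ⟨fun i => ?_, fun i hi => ?_, fun i => ?_⟩, by simp [hσm]⟩
  · have e : ∀ x, σ (Equiv.swap a m x) = Equiv.swap a m (σ x) := fun x => by
      have := congrArg (fun τ => τ (σ x)) (Equiv.swap_apply_apply σ a m)
      simpa [hσm, hσa] using this.symm
    simp [e, h1]
  · have : σ i = i := h2 i (by simp [hi])
    have h5 : i ≠ a := fun h => hi (h ▸ ha)
    have h6 : i ≠ m := fun h => hi (h ▸ hm)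
    simp [this, Equiv.swap_apply_of_ne_of_ne h5 h6]
  · rw [← h3 i, Equiv.Perm.mul_apply]
    rw [Equiv.swap_apply_def]
    split_ifs with h h'
    exacts [by rw [h, hc], by rw [h', hc], rfl]

theorem swap_mul_mem_erase {S : Finset α} {c : α → ι} {m a : α} {σ : Equiv.Perm α}
    (hσ : σ ∈ colorInvolutions S c) (hσm : σ m = a) :
    Equiv.swap a m * σ ∈ colorInvolutions ((S.erase m).erase a) c := by
  obtain ⟨h1, h2, h3⟩ := mem_colorInvolutions.mp hσ
  have hσa : σ a = m := by rw [← hσm, h1]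
  have hfix : ∀ x, x ≠ a → x ≠ m → Equiv.swap a m (σ x) = σ x := fun x hxa hxm =>
    Equiv.swap_apply_of_ne_of_ne (fun h => hxm (σ.injective (h.trans hσm.symm)))
      (fun h => hxa (σ.injective (h.trans hσa.symm)))
  have hca : (Equiv.swap a m * σ) a = a := by simp [hσa]
  have hcm : (Equiv.swap a m * σ) m = m := by simp [hσm]
  have hcx : ∀ x, x ≠ a → x ≠ m → (Equiv.swap a m * σ) x = σ x := fun x hxa hxm => by
    simp [hfix x hxa hxm]
  refine mem_colorInvolutions.mpr ⟨fun i => ?_, fun i hi => ?_, fun i => ?_⟩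
  · by_cases hia : i = a
    · rw [hia, hca, hca]
    by_cases him : i = m
    · rw [him, hcm, hcm]
    rw [hcx i hia him, hcx (σ i) (fun h => him (σ.injective (h.trans hσm.symm)))
      (fun h => hia (σ.injective (h.trans hσa.symm))), h1]
  · by_cases hia : i = a
    · rw [hia, hca]
    by_cases him : i = m
    · rw [him, hcm]
    rw [hcx i hia him, h2 i fun h => hi (by simp [hia, him, h])]
  · by_cases hia : i = a
    · rw [hia, hca]
    by_cases him : i = m
    · rw [him, hcm]
    rw [hcx i hia him, h3]

/-- The new pairs are the `(a, j)` with `j` of the same colour and `a < j < m`; their last condition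
holds automatically because `m` is the maximum. No pair `(i, a)` occurs, since `a` is sent to `m`.
Two more points and one more transposition give a single factor `1 - p` and one factor `p`. -/
theorem invWeight_swap_mul (p : ℝ) {S : Finset α} {c : α → ι} {m a : α} (hm : m ∈ S)
    (hmax : ∀ x ∈ S, x ≤ m) (ha : a ∈ S) (ham : a ≠ m) (hc : c a = c m) {σ : Equiv.Perm α}
    (hσ : σ ∈ colorInvolutions ((S.erase m).erase a) c) :
    invWeight p S c (Equiv.swap a m * σ)
      = (1 - p) * p * p ^ (((S.filter fun i => c i = c m).erase m).filter fun j => a < j).card *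
        invWeight p ((S.erase m).erase a) c σ := by
  have hle := halfSupport_le hσ
  obtain ⟨h1, h2, h3⟩ := mem_colorInvolutions.mp hσ
  have hσm : σ m = m := h2 m (by simp)
  have hσa : σ a = a := h2 a (by simp)
  have hta : (Equiv.swap a m * σ) a = m := by simp [hσa]
  have htm : (Equiv.swap a m * σ) m = a := by simp [hσm]
  have htx : ∀ x, x ≠ a → x ≠ m → (Equiv.swap a m * σ) x = σ x := fun x hxa hxm =>
    Equiv.swap_apply_of_ne_of_ne (fun h => hxa (σ.injective (h.trans hσa.symm)))
      (fun h => hxm (σ.injective (h.trans hσm.symm)))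
  have hlt : a < m := lt_of_le_of_ne (hmax a ha) ham
  have hlm : ∀ x ∈ S, x ≠ a → x ≠ m → σ x < m := fun x hx hxa hxm => by
    have := apply_mem_of_mem hσ (i := x) (by simp [hx, hxa, hxm])
    simp only [Finset.mem_erase] at this
    exact lt_of_le_of_ne (hmax _ this.2.2) this.2.1
  generalize Equiv.swap a m * σ = τ at *
  have hhalf : halfSupport τ = halfSupport σ + 1 := by
    have : (Finset.univ.filter fun i => τ i ≠ i)
        = insert a (insert m (Finset.univ.filter fun i => σ i ≠ i)) := by
      ext i
      simp only [Finset.mem_filter, Finset.mem_univ, true_and, Finset.mem_insert]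
      by_cases hia : i = a
      · simp [hia, hta, ham.symm]
      by_cases him : i = m
      · simp [him, htm, ham]
      simp [hia, him, htx i hia him]
    rw [halfSupport, halfSupport, this, Finset.card_insert_of_notMem,
      Finset.card_insert_of_notMem]
    · omega
    · simp [hσm]
    · simp [hσa, ham]
  have hpairs : colorPairs S c τ = colorPairs ((S.erase m).erase a) c σ ∪
      {a} ×ˢ (((S.filter fun i => c i = c m).erase m).filter fun j => a < j) := by
    ext ⟨i, j⟩
    simp only [colorPairs, Finset.mem_filter, Finset.mem_product, Finset.mem_erase,
      Finset.mem_union, Finset.mem_singleton]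
    by_cases hia : i = a
    · subst hia
      simp only [hta, ne_eq, not_true_eq_false, false_and, false_or, true_and, hc]
      constructor
      · rintro ⟨⟨_, hj⟩, hcj, hij, hjm, _⟩
        exact ⟨⟨hjm.ne, hj, hcj.symm⟩, hij⟩
      · rintro ⟨⟨hjm, hj, hcj⟩, hij⟩
        refine ⟨⟨ha, hj⟩, hcj.symm, hij, lt_of_le_of_ne (hmax j hj) hjm, ?_⟩
        rw [htx j hij.ne' hjm]
        exact hlm j hj hij.ne' hjm
    by_cases him : i = m
    · subst him
      simp only [htm, ne_eq, not_true_eq_false, false_and, and_false, hia, or_false, iff_false]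
      rintro ⟨_, _, h4, h5, _⟩
      exact absurd (h4.trans h5) hlt.asymm
    simp only [hia, him, false_and, or_false, ne_eq, not_false_eq_true, true_and, htx i hia him]
    constructor
    · rintro ⟨⟨hi, hj⟩, hcj, hij, hjs, hs⟩
      have hsm := hlm i hi hia him
      have hja : j ≠ a := by
        rintro rfl
        rw [hta] at hs
        exact hs.asymm hsm
      have hjm : j ≠ m := (hjs.trans hsm).ne
      rw [htx j hja hjm] at hs
      exact ⟨⟨hi, hja, hjm, hj⟩, hcj, hij, hjs, hs⟩
    · rintro ⟨⟨hi, hja, hjm, hj⟩, hcj, hij, hjs, hs⟩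
      rw [htx j hja hjm]
      exact ⟨⟨hi, hj⟩, hcj, hij, hjs, hs⟩
  have hcard := Finset.card_erase_add_one hm
  have hcard' := Finset.card_erase_add_one (Finset.mem_erase.mpr ⟨ham, ha⟩)
  rw [invWeight, invWeight, hpairs, hhalf, Finset.card_union_of_disjoint, Finset.card_product,
    ← hcard, ← hcard',
    show ((S.erase m).erase a).card + 1 + 1 - (halfSupport σ + 1)
      = ((S.erase m).erase a).card - halfSupport σ + 1 by omega, Finset.card_singleton, one_mul]
  · ring
  · rw [Finset.disjoint_left]
    rintro ⟨i, j⟩ hx hy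
    simp only [colorPairs, Finset.mem_filter, Finset.mem_product, Finset.mem_erase,
      Finset.mem_singleton] at hx hy
    exact hx.1.1.1 hy.1

theorem sum_invWeight_of_max (p : ℝ) {S : Finset α} (c : α → ι) {m : α} (hm : m ∈ S)
    (hmax : ∀ x ∈ S, x ≤ m) :
    ∑ σ ∈ colorInvolutions S c, invWeight p S c σ
      = (1 - p) * ∑ σ ∈ colorInvolutions (S.erase m) c, invWeight p (S.erase m) c σ
        + ∑ a ∈ (S.filter fun i => c i = c m).erase m,
          (1 - p) * p * p ^ (((S.filter fun i => c i = c m).erase m).filter fun j => a < j).card *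
          ∑ σ ∈ colorInvolutions ((S.erase m).erase a) c,
            invWeight p ((S.erase m).erase a) c σ := by
  have hmaps : ∀ σ ∈ colorInvolutions S c, σ m ∈ S.filter fun i => c i = c m := fun σ hσ =>
    Finset.mem_filter.mpr ⟨apply_mem_of_mem hσ hm, (mem_colorInvolutions.mp hσ).2.2 m⟩
  have hmf : m ∈ S.filter fun i => c i = c m := Finset.mem_filter.mpr ⟨hm, rfl⟩
  rw [← Finset.sum_fiberwise_of_maps_to hmaps, ← Finset.add_sum_erase _ _ hmf, colorInvolutions_filter_fixed,
    Finset.mul_sum]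
  congr 1
  · exact Finset.sum_congr rfl fun σ hσ => invWeight_of_fixed p hm hmax hσ
  · refine Finset.sum_congr rfl fun a ha => ?_
    simp only [Finset.mem_erase, Finset.mem_filter] at ha
    rw [Finset.mul_sum]
    -- Left multiplication by the transposition is its own inverse; it matches the involutions
    -- sending `m` to `a` with those fixing both points.
    refine Finset.sum_nbij' (fun σ => Equiv.swap a m * σ) (fun σ => Equiv.swap a m * σ)
      ?_ ?_ ?_ ?_ ?_
    · intro σ hσ
      obtain ⟨h1, h2⟩ := Finset.mem_filter.mp hσ
      exact swap_mul_mem_erase h1 h2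
    · intro σ hσ
      exact Finset.mem_filter.mpr (swap_mul_mem hm ha.2.1 ha.2.2 hσ)
    · intro σ _
      simp [← mul_assoc]
    · intro σ _
      simp [← mul_assoc]
    · intro σ hσ
      obtain ⟨h1, h2⟩ := Finset.mem_filter.mp hσ
      rw [← invWeight_swap_mul p hm hmax ha.2.1 ha.1 ha.2.2 (swap_mul_mem_erase h1 h2),
        Equiv.swap_mul_self_mul]

/-- The weighted number of colour-preserving involutions factors over the colour classes. -/
theorem sum_invWeight {p : ℝ} [Fintype ι] (c : α → ι) (N : ℕ) : ∀ S : Finset α, S.card ≤ N →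
    ∑ σ ∈ colorInvolutions S c, invWeight p S c σ
      = ∏ l, symDensity p (S.filter fun i => c i = l).card := by
  induction N using Nat.strong_induction_on with
  | _ N ih =>
  intro S hS
  rcases S.eq_empty_or_nonempty with rfl | hne
  · have : colorInvolutions (∅ : Finset α) c = {1} := by
      ext σ
      simp only [mem_colorInvolutions, Finset.mem_singleton]
      constructor
      · rintro ⟨-, h, -⟩
        ext i
        exact h i (Finset.notMem_empty i)
      · rintro rfl
        simp
    rw [this]
    simp [invWeight, halfSupport, colorPairs, symDensity]
  obtain ⟨m, hm, hmax⟩ : ∃ m ∈ S, ∀ x ∈ S, x ≤ m :=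
    ⟨S.max' hne, S.max'_mem hne, fun x hx => S.le_max' x hx⟩
  have hc1 := Finset.card_erase_add_one hm
  rw [sum_invWeight_of_max p c hm hmax, ih (S.erase m).card (by omega) _ le_rfl]
  set T := (S.filter fun i => c i = c m).erase m with hT
  have hmf : m ∈ S.filter fun i => c i = c m := Finset.mem_filter.mpr ⟨hm, rfl⟩
  have hTcard : T.card + 1 = (S.filter fun i => c i = c m).card := Finset.card_erase_add_one hmf
  have hother : ∀ a, c a = c m → ∀ l ∈ Finset.univ.erase (c m), ∀ S' : Finset α,
      ((S'.erase a).filter fun i => c i = l) = S'.filter fun i => c i = l := by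
    intro a ha l hl S'
    rw [Finset.filter_erase, Finset.erase_eq_of_notMem]
    intro h
    exact (Finset.mem_erase.mp hl).1 ((Finset.mem_filter.mp h).2.symm.trans ha)
  set R := ∏ l ∈ Finset.univ.erase (c m), symDensity p (S.filter fun i => c i = l).card with hR
  have hfirst : ∏ l, symDensity p ((S.erase m).filter fun i => c i = l).card
      = symDensity p T.card * R := by
    rw [← Finset.mul_prod_erase _ _ (Finset.mem_univ (c m)), Finset.filter_erase]
    congr 1
    exact Finset.prod_congr rfl fun l hl => by rw [hother m rfl l hl]
  have hrest : ∀ a ∈ T, (1 - p) * p * p ^ (T.filter fun j => a < j).card *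
      ∑ σ ∈ colorInvolutions ((S.erase m).erase a) c, invWeight p ((S.erase m).erase a) c σ
      = p ^ (T.filter fun j => a < j).card *
        ((1 - p) * p * (symDensity p (T.card - 1) * R)) := by
    intro a ha
    have ha' := ha
    simp only [hT, Finset.mem_erase, Finset.mem_filter] at ha'
    have := Finset.card_erase_le (s := S.erase m) (a := a)
    have hTa : ((S.erase m).erase a).filter (fun i => c i = c m) = T.erase a := by
      rw [Finset.filter_erase, Finset.filter_erase]
    rw [ih ((S.erase m).erase a).card (by omega) _ le_rfl,
      ← Finset.mul_prod_erase _ _ (Finset.mem_univ (c m)), hTa, Finset.card_erase_of_mem ha,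
      Finset.prod_congr rfl fun l hl => by rw [hother a ha'.2.2 l hl, hother m rfl l hl]]
    ring
  rw [hfirst, Finset.sum_congr rfl hrest, ← Finset.sum_mul, sum_pow_card_gt,
    ← Finset.mul_prod_erase _ _ (Finset.mem_univ (c m)), ← hR, ← hTcard]
  -- If `T` is empty, the truncated `T.card - 1` is harmless, as the geometric sum vanishes.
  -- Otherwise the colour class of `m` has `k + 2` points, and the geometric sum supplies the factor
  -- `1 - p ^ (k + 1)` of the recursion.
  rcases T.card with _ | k
  · simp [symDensity]
  · have hgeom : (1 - p) * ∑ i ∈ Finset.range (k + 1), p ^ i = 1 - p ^ (k + 1) :=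
      mul_neg_geom_sum p (k + 1)
    rw [symDensity, ← hgeom, Nat.add_sub_cancel]
    ring

end Order


/-! ### Exchange of the sums and conclusion -/

/-- The sum over the involutions stabilising the blocks of a fixed partition. -/
theorem sum_involutions_stable {p : ℝ} {n r : ℕ} {I : Fin (r + 1) → Finset (Fin n)}
    (hI : I ∈ orderedPartitions (r + 1) Finset.univ) :
    ∑ σ ∈ (involutions n).filter (fun σ => ∀ l, ∀ i ∈ I l, σ i ∈ I l),
      (1 - p) ^ (n - c₂ σ) * p ^ (c₂ σ + tInv σ I) = ∏ l, symDensity p (I l).card := by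
  obtain ⟨-, hd, hS⟩ := mem_orderedPartitions.mp hI
  -- The colour of a point is the index of its block; stabilising all blocks then means preserving
  -- `c`.
  choose c hc using fun i => (hS i).mp (Finset.mem_univ i)
  have hmem : ∀ i l, i ∈ I l ↔ c i = l := fun i l =>
    ⟨fun h => by_contra fun hne => Finset.disjoint_left.mp (hd _ _ hne) (hc i) h, fun h => h ▸ hc i⟩
  have hfil : ∀ l, (Finset.univ.filter fun i => c i = l) = I l := fun l => by
    ext i
    simp [hmem]
  have key := sum_invWeight (p := p) c _ Finset.univ le_rfl
  simp only [hfil] at key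
  rw [← key]
  refine Finset.sum_congr ?_ fun σ _ => ?_
  · ext σ
    have : (∀ l, ∀ i ∈ I l, σ i ∈ I l) ↔ ∀ i, c (σ i) = c i := by
      simp only [hmem]
      exact ⟨fun h i => h _ i rfl, fun h l i hi => (h i).trans hi⟩
    simp [involutions, colorInvolutions, this]
  · have ht : tInv σ I = (colorPairs Finset.univ c σ).card := by
      rw [Finset.card_eq_sum_card_fiberwise (f := fun x => c x.1) (t := Finset.univ) (by simp)]
      refine Finset.sum_congr rfl fun l _ => congrArg Finset.card ?_
      ext ⟨i, j⟩
      simp only [colorPairs, Finset.mem_filter, Finset.mem_product, hmem, Finset.mem_univ,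
        true_and]
      constructor
      · rintro ⟨⟨rfl, h⟩, h'⟩
        exact ⟨⟨h.symm, h'⟩, rfl⟩
      · rintro ⟨⟨h, h'⟩, rfl⟩
        exact ⟨⟨rfl, h.symm⟩, h'⟩
    rw [ht, invWeight, Finset.card_univ, Fintype.card_fin]
    rfl

theorem stablePartitions_eq {n r : ℕ} (σ : Equiv.Perm (Fin n)) :
    stablePartitions σ r = (orderedPartitions (r + 1) Finset.univ).filter
      fun I => ∀ l, ∀ i ∈ I l, σ i ∈ I l := by
  ext I
  simp [stablePartitions, IsStablePartition, mem_orderedPartitions, and_assoc]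

/-- The contribution of the partitions into `r + 1` blocks. -/
theorem sum_stablePartitions {p : ℝ} (h0 : 0 < p) (n r : ℕ) :
    ∑ σ ∈ involutions n, ∑ I ∈ stablePartitions σ r,
      (1 - p) ^ (n - c₂ σ) * p⁻¹ ^ (-(c₂ σ : ℤ)) *
        (p⁻¹ ^ (-(tau I : ℤ) - (tInv σ I : ℤ)) *
          (p⁻¹ ^ (n * (n + 1) / 2) / ∏ l : Fin (r + 1), (p⁻¹ ^ nTri I l - 1)))
      = p⁻¹ ^ (n * (n + 1) / 2) * partitionSum p (r + 1) (Finset.univ : Finset (Fin n)) := by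
  simp only [stablePartitions_eq, Finset.sum_filter]
  rw [Finset.sum_comm, partitionSum, Finset.mul_sum]
  refine Finset.sum_congr rfl fun I hI => ?_
  rw [← Finset.sum_filter, Finset.prod_div_distrib, ← sum_involutions_stable hI, Finset.sum_div,
    Finset.mul_sum, Finset.mul_sum]
  refine Finset.sum_congr rfl fun σ _ => ?_
  have e1 : p⁻¹ ^ (-(c₂ σ : ℤ)) = p ^ c₂ σ := by simp
  have e2 : p⁻¹ ^ (-(tau I : ℤ) - (tInv σ I : ℤ)) = p ^ tau I * p ^ tInv σ I := by
    rw [← neg_add', zpow_neg, inv_zpow, inv_inv, zpow_add₀ h0.ne', zpow_natCast, zpow_natCast]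
  have e3 : tau I = crossings I := rfl
  have e4 : ∀ l, nTri I l = upperCard I l * (upperCard I l + 1) / 2 := fun _ => rfl
  rw [e1, e2, e3, pow_add]
  simp only [e4]
  ring

end SiegelIdentity

theorem proposition5p1 (F : Type*) [Field F] [ValuativeRel F] [TopologicalSpace F]
    [IsNonarchimedeanLocalField F] (q : ℕ) (hq : q = Nat.card 𝓀[F]) (hodd : Odd q)
    (n : ℕ) (hn : 1 ≤ n) :
    ∑ σ ∈ SiegelIdentity.involutions n,
      (1 - (q : ℝ)⁻¹) ^ (n - SiegelIdentity.c₂ σ) * (q : ℝ) ^ (-(SiegelIdentity.c₂ σ : ℤ)) *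
        -- a partition of `n` points into `r + 1` non-empty blocks has `r < n`
        ∑ r ∈ Finset.range n, ∑ I ∈ SiegelIdentity.stablePartitions σ r,
          (q : ℝ) ^ (-(SiegelIdentity.tau I : ℤ) - (SiegelIdentity.tInv σ I : ℤ)) *
            ((q : ℝ) ^ (n * (n + 1) / 2) /
              ∏ l : Fin (r + 1), ((q : ℝ) ^ SiegelIdentity.nTri I l - 1)) = 1 := by
  open SiegelIdentity in
  have hq1 : 1 < q := by
    have h1 : q ≠ 1 := fun h => by
      rw [h] at hq
      exact not_subsingleton 𝓀[F] (Nat.card_eq_one_iff_unique.mp hq.symm).1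
    -- Oddness rules out `q = 0`, the value of `Nat.card` on an infinite type.
    have := hodd.pos
    omega
  have hqr : (1 : ℝ) < q := by exact_mod_cast hq1
  have h0 : (0 : ℝ) < (q : ℝ)⁻¹ := inv_pos.mpr (by linarith)
  have h1 : (q : ℝ)⁻¹ < 1 := inv_lt_one_of_one_lt₀ hqr
  have hterm := fun r => sum_stablePartitions h0 n r
  simp only [inv_inv] at hterm
  simp only [Finset.mul_sum]
  rw [Finset.sum_comm]
  simp only [hterm]
  rw [← Finset.mul_sum]
  -- With `n + 1` the range covers `0, …, n` blocks; the term for no blocks vanishes as `n ≥ 1`,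
  -- which leaves `r + 1` blocks with `r < n`.
  have key := sum_partitionSum h0 h1 (n + 1) (Finset.univ : Finset (Fin n)) (by simp)
  have hne : (Finset.univ : Finset (Fin n)) ≠ ∅ :=
    Finset.nonempty_iff_ne_empty.mp ⟨⟨0, hn⟩, Finset.mem_univ _⟩
  rw [Finset.sum_range_succ', partitionSum_zero, if_neg hne, add_zero, Finset.card_univ,
    Fintype.card_fin] at key
  rw [key, ← mul_pow, mul_inv_cancel₀ (by linarith), one_pow]
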